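/- Let $o_{\mathrm T}, o_{\mathrm R}$ be independent random unit vectors, each uniformly distributed on the unit sphere of $\mathbb R^3$, and let $d\in\mathbb R^3$ be a fixed unit vector. Let $J_*$ be either the near-field alignment factor $J_{\mathrm{NF}} = o_{\mathrm R}^{\mathsf T}\,\tfrac12(3dd^{\mathsf T}-I)\,o_{\mathrm T}$ or the far-field alignment factor $J_{\mathrm{FF}} = o_{\mathrm R}^{\mathsf T}(I-dd^{\mathsf T})\,o_{\mathrm T}$. Its probability density is, respectively, $$f_{J_{\mathrm{NF}}}(x)=\frac{\operatorname{arcosh}2}{\sqrt3}\cdot\begin{cases}1,& |x|\le\frac12,\\ 1-\frac{\operatorname{arcosh}(2|x|)}{\operatorname{arcosh}2},&\frac12<|x|<1,\\ 0,&|x|\ge1,\end{cases}\qquad f_{J_{\mathrm{FF}}}(x)=\tfrac12\bigl(\tfrac{\pi}{2}-\arcsin|x|\bigr)\mathbf 1_{[-1,1]}(x).$$ Consider a link with random channel coefficient $h\in\mathbb C$, transmit power $P_{\mathrm T}>0$ and complex additive white Gaussian noise (circularly symmetric, independent of $h$ and the data) of power $P_{\mathrm N}>0$. Model the near- or far-field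 region by $|h|^2=|h_{\mathrm{opt}}|^2J_*^2$ almost surely, with $h_{\mathrm{opt}}\in\mathbb C\setminus\{0\}$ constant, so that $\mathrm{SNR}=|h|^2P_{\mathrm T}/P_{\mathrm N}=J_*^2\cdot\mathrm{SNR}_{\mathrm{opt}}$ with $\mathrm{SNR}_{\mathrm{opt}}=|h_{\mathrm{opt}}|^2P_{\mathrm T}/P_{\mathrm N}$. Then the bit error rate of BPSK with equiprobable bits and coherent maximum-likelihood detection (the error probability given $h$, averaged over $h$) satisfies $$\mathrm{BER}<\frac{f_{J_*}(0)}{\sqrt{\pi\cdot\mathrm{SNR}_{\mathrm{opt}}}},$$ and this bound is tight for large $\mathrm{SNR}_{\mathrm{opt}}$: the ratio of the two sides tends to $1$ as $\mathrm{SNR}_{\mathrm{opt}}\to\infty$. Consequently the diversity exponent is $\tfrac12$: as $\mathrm{SNR}_{\mathrm{opt}}\to\infty$, $\mathrm{BER}\sim c\,\mathrm{SNR}_{\mathrm{opt}}^{-1/2}$ with a constant $c>0$. -/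

import Mathlib

open MeasureTheory ProbabilityTheory Filter Topology Asymptotics

noncomputable section

/-- Three-dimensional Euclidean space. -/
abbrev E3 : Type := EuclideanSpace ℝ (Fin 3)

/-- The unit sphere of `E3`, i.e. the set of dipole axis directions. -/
abbrev S2 : Type := Metric.sphere (0 : E3) 1

/-- The uniform distribution on the unit sphere: normalized surface measure. -/
def uniformSphere : Measure S2 :=
  ((volume : Measure E3).toSphere Set.univ)⁻¹ • (volume : Measure E3).toSphere

/-- The two regions in which the channel is described by a single alignment factor. -/
inductive Region where
  | near
  | far

/-- Scaled field vector at direction `d` (from transmitter to receiver) of a transmitting dipole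
with axis `o`: the near field is `(1/2) (3 d dᵀ - I) o`, the far field is `(I - d dᵀ) o`. -/
def Region.fieldVec : Region → E3 → E3 → E3
  | .near, d, o => (1 / 2 : ℝ) • ((3 : ℝ) • (inner ℝ d o • d) - o)
  | .far, d, o => o - inner ℝ d o • d

/-- Alignment factor `J = oRxᵀ b`, with `b` the scaled near or far field. -/
def Region.alignment (R : Region) (d : S2) (oTx oRx : S2) : ℝ :=
  inner ℝ (oRx : E3) (R.fieldVec d oTx)

/-- The constant `√3 / (2 arcosh 2)` of the near-field density. -/
def betaBarNear : ℝ := √3 / (2 * Real.arcosh 2)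

/-- The probability density function of the alignment factor for uniform random orientations. -/
def Region.pdf : Region → ℝ → ℝ
  | .near, x =>
      1 / (2 * betaBarNear) *
        (if |x| ≤ 1 / 2 then 1
         else if |x| < 1 then 1 - Real.arcosh (2 * |x|) / Real.arcosh 2
         else 0)
  | .far, x =>
      Set.indicator (Set.Icc (-1) 1) (fun x => 1 / 2 * (Real.pi / 2 - Real.arcsin |x|)) x

/-- Circularly symmetric complex Gaussian noise of power `pN`: the real and imaginary parts are
independent centred Gaussians of variance `pN / 2`. -/
def complexNoise (pN : ℝ) : Measure ℂ :=
  ((gaussianReal 0 (pN / 2).toNNReal).prod (gaussianReal 0 (pN / 2).toNNReal)).map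
    (fun z : ℝ × ℝ => (⟨z.1, z.2⟩ : ℂ))

/-- The antipodal (BPSK) symbol of a bit. -/
def bpskSymbol (b : Bool) : ℝ := if b then 1 else -1

/-- Coherent maximum-likelihood detection of the bit from the received value `y`, for known channel
coefficient `h`. -/
def bpskDetect (h y : ℂ) : Bool := decide (0 ≤ ((starRingEnd ℂ) h * y).re)

/-- Bit error probability of BPSK with transmit power `pTx` in additive white Gaussian noise of
power `pN` for a given channel coefficient `h`: an equiprobable bit `b` is received as
`h * (√pTx * bpskSymbol b) + w` with `w` the noise. -/
def bpskErrorProb (pTx pN : ℝ) (h : ℂ) : ℝ :=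
  ∑ b : Bool, (1 / 2 : ℝ) * (complexNoise pN).real
    {w : ℂ | bpskDetect h (h * ((√pTx * bpskSymbol b : ℝ) : ℂ) + w) ≠ b}

/-- A link with transmit power `pTx`, noise power `pN` and random channel coefficient `h` that is
governed by the alignment factor `J`: `|h|² = |hOpt|² J²`, where `hOpt` is the channel coefficient
for optimal orientations (`|J| = 1`). -/
structure FadingLink {Ω : Type*} [MeasurableSpace Ω] (P : Measure Ω) (J : Ω → ℝ) where
  pTx : ℝ
  pN : ℝ
  hOpt : ℂ
  h : Ω → ℂ
  pTx_pos : 0 < pTx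
  pN_pos : 0 < pN
  hOpt_ne_zero : hOpt ≠ 0
  aemeasurable_h : AEMeasurable h P
  sq_norm_h : ∀ᵐ ω ∂P, ‖h ω‖ ^ 2 = ‖hOpt‖ ^ 2 * J ω ^ 2

namespace FadingLink

variable {Ω : Type*} [MeasurableSpace Ω] {P : Measure Ω} {J : Ω → ℝ}

/-- The optimal signal-to-noise ratio `|hOpt|² pTx / pN`; the random signal-to-noise ratio
`|h|² pTx / pN` is almost surely `J²` times this. -/
def snrOpt (L : FadingLink P J) : ℝ := ‖L.hOpt‖ ^ 2 * L.pTx / L.pN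

/-- The bit error rate of BPSK in additive white Gaussian noise: the error probability given the
channel coefficient, averaged over the fading. -/
def ber (L : FadingLink P J) : ℝ := ∫ ω, bpskErrorProb L.pTx L.pN (L.h ω) ∂P

end FadingLink

/-- The error probability `pe` has diversity exponent `e`: it is asymptotically equivalent to
a positive constant times `snr ^ (-e)` as `snr → ∞`. -/
def HasDiversityExponent {α : Type*} (snr pe : α → ℝ) (e : ℝ) : Prop :=
  ∃ c : ℝ, 0 < c ∧ pe ~[comap snr atTop] fun a => c * snr a ^ (-e)

end

/-! Everything about the geometry enters through the density of `J`, and only its value and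
behaviour at 0 matter for the error rate.

Density: given the transmitter axis, `J` is the inner product of a uniform unit vector with a fixed
vector `b`, so by Archimedes' hat-box theorem it is uniform on `[-‖b‖, ‖b‖]`. The norm `‖b‖` depends
only on the cosine `u` between that axis and `d`, and `u` is itself uniform on `[-1, 1]`. The
density at `x` is therefore half the integral of `1 / (2 ‖b‖)` over those `u` with `|x| ≤ ‖b‖`, an
elementary integral (`Region.lintegral_uniformDensity_gain`).

Error rate: given `h`, the detector errs with probability `Q(√(2 SNR))`, where `Q` is the Gaussian
tail, so the error rate is the integral of `f(x) Q(√(2 s) |x|)` with `f` the density and `s` the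
optimal SNR. Since `f ≤ f(0)` and `Q(|x|)` has integral `√(2/π)`, replacing `f` by `f(0)` gives the
bound. For large `s` the factor `Q` concentrates at 0, where `f` is continuous, so nothing is lost
in the limit. The bound is a constant times `s ^ (-1/2)`, which gives the diversity exponent. -/

/-! ### Archimedes' hat-box theorem -/

open scoped ENNReal in
theorem lintegral_comp_const_mul {c : ℝ} (hc : 0 < c) {f : ℝ → ℝ≥0∞} (hf : Measurable f) :
    ∫⁻ t, f (c * t) = ENNReal.ofReal c⁻¹ * ∫⁻ x, f x := by
  rw [← lintegral_map (f := f) (g := fun t => c * t) hf (by fun_prop),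
    Real.map_volume_mul_left hc.ne', lintegral_smul_measure, abs_of_pos (by positivity)]
  rfl

/-- A disc of squared radius `a` has area `π a`, linear in `a`. This linearity is what makes
projections of the sphere in dimension three uniform. -/
theorem map_volume_sq_add_sq :
    Measure.map (fun y : Fin 2 → ℝ => y 0 ^ 2 + y 1 ^ 2) volume =
      ENNReal.ofReal Real.pi • volume.restrict (Set.Ici 0) := by
  have hm : Measurable (fun y : Fin 2 → ℝ => y 0 ^ 2 + y 1 ^ 2) := by fun_prop
  have hball : ∀ a : ℝ, volume ((fun y : Fin 2 → ℝ => y 0 ^ 2 + y 1 ^ 2) ⁻¹' Set.Iio a) =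
      ENNReal.ofReal Real.pi * ENNReal.ofReal a := by
    intro a
    rcases le_or_gt a 0 with ha | ha
    · have : (fun y : Fin 2 → ℝ => y 0 ^ 2 + y 1 ^ 2) ⁻¹' Set.Iio a = ∅ := by
        ext y
        simp only [Set.mem_preimage, Set.mem_Iio, Set.mem_empty_iff_false, iff_false, not_lt]
        have := sq_nonneg (y 0); have := sq_nonneg (y 1); linarith
      rw [this, measure_empty, ENNReal.ofReal_of_nonpos ha, mul_zero]
    · have h := (PiLp.volume_preserving_toLp (Fin 2)).measure_preimage
        (s := Metric.ball (0 : EuclideanSpace ℝ (Fin 2)) √a) measurableSet_ball.nullMeasurableSet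
      have hs : (WithLp.toLp 2 : (Fin 2 → ℝ) → EuclideanSpace ℝ (Fin 2)) ⁻¹' Metric.ball 0 √a =
          (fun y : Fin 2 → ℝ => y 0 ^ 2 + y 1 ^ 2) ⁻¹' Set.Iio a := by
        ext y
        simp only [Set.mem_preimage, mem_ball_zero_iff, Set.mem_Iio, EuclideanSpace.norm_eq,
          Fin.sum_univ_two, Real.norm_eq_abs, sq_abs]
        exact Real.sqrt_lt_sqrt_iff (by positivity)
      rw [← hs, h, EuclideanSpace.volume_ball, mul_comm]
      have hG : Real.Gamma (1 + 1) = 1 := by norm_num [Real.Gamma_two]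
      simp [hG, ← ENNReal.ofReal_pow (Real.sqrt_nonneg a), Real.sq_sqrt ha.le,
        Real.sq_sqrt Real.pi_pos.le]
  have hrestr : ∀ a : ℝ, (ENNReal.ofReal Real.pi • volume.restrict (Set.Ici (0 : ℝ))) (Set.Iio a) =
      ENNReal.ofReal Real.pi * ENNReal.ofReal a := by
    intro a
    rw [Measure.smul_apply, Measure.restrict_apply measurableSet_Iio, smul_eq_mul, Set.inter_comm,
      Set.Ici_inter_Iio, Real.volume_Ico, sub_zero]
  refine Measure.ext_of_Ico' _ _ (fun a b hab => ?_) (fun a b hab => ?_)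
  · refine ne_top_of_le_ne_top ?_ (measure_mono Set.Ico_subset_Iio_self)
    rw [Measure.map_apply hm measurableSet_Iio, hball]
    exact ENNReal.mul_ne_top ENNReal.ofReal_ne_top ENNReal.ofReal_ne_top
  · have hd : Set.Ico a b = Set.Iio b \ Set.Iio a := by
      ext; simp
    rw [hd, measure_sdiff (Set.Iio_subset_Iio hab.le) measurableSet_Iio.nullMeasurableSet,
      measure_sdiff (Set.Iio_subset_Iio hab.le) measurableSet_Iio.nullMeasurableSet, hrestr, hrestr,
      Measure.map_apply hm measurableSet_Iio, Measure.map_apply hm measurableSet_Iio, hball, hball]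
    · rw [hrestr]; exact ENNReal.mul_ne_top ENNReal.ofReal_ne_top ENNReal.ofReal_ne_top
    · rw [Measure.map_apply hm measurableSet_Iio, hball]
      exact ENNReal.mul_ne_top ENNReal.ofReal_ne_top ENNReal.ofReal_ne_top

-- Cylindrical coordinates about `d`: complete `d` to an orthonormal basis, take `z` as first
-- coordinate and replace the other two by their squared radius. The second variable `w` is then
-- shifted by `z ^ 2` to become the full squared norm.
open scoped ENNReal in
theorem lintegral_inner_norm_sq {d : E3} (hd : ‖d‖ = 1) {F : ℝ → ℝ → ℝ≥0∞}
    (hF : Measurable (Function.uncurry F)) :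
    ∫⁻ x : E3, F (inner ℝ d x) (‖x‖ ^ 2) =
      ENNReal.ofReal Real.pi * ∫⁻ z, ∫⁻ w in Set.Ici (z ^ 2), F z w := by
  obtain ⟨b, hb⟩ := Orthonormal.exists_orthonormalBasis_extension_of_card_eq (𝕜 := ℝ) (E := E3)
    (ι := Fin 3) (v := fun _ => d) (s := {0}) (by simp) (by
      constructor
      · intro i; simpa using hd
      · intro i j hij; exact absurd (Subsingleton.elim i j) hij)
  have hb0 : b 0 = d := hb 0 rfl
  have h1 : ∀ x : E3, F (inner ℝ d x) (‖x‖ ^ 2) =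
      (fun p : Fin 3 → ℝ => F (p 0) (p 0 ^ 2 + (p 1 ^ 2 + p 2 ^ 2))) (WithLp.ofLp (b.repr x)) := by
    intro x
    have : ‖x‖ ^ 2 = (b.repr x) 0 ^ 2 + ((b.repr x) 1 ^ 2 + (b.repr x) 2 ^ 2) := by
      rw [← b.repr.norm_map x, EuclideanSpace.norm_sq_eq, Fin.sum_univ_three]
      simp [add_assoc]
    simp only [this, ← hb0, ← b.repr_apply_apply]
  have hmp := (PiLp.volume_preserving_ofLp (Fin 3)).comp b.measurePreserving_repr
  have hmeas : Measurable (fun p : Fin 3 → ℝ => F (p 0) (p 0 ^ 2 + (p 1 ^ 2 + p 2 ^ 2))) :=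
    hF.comp (f := fun p : Fin 3 → ℝ => (p 0, p 0 ^ 2 + (p 1 ^ 2 + p 2 ^ 2))) (by fun_prop)
  have hsplit := (volume_preserving_piFinSuccAbove (fun _ : Fin 3 => ℝ) 0)
  have hmeas' : Measurable (fun q : ℝ × (Fin 2 → ℝ) =>
      F q.1 (q.1 ^ 2 + (q.2 0 ^ 2 + q.2 1 ^ 2))) :=
    hF.comp (f := fun q : ℝ × (Fin 2 → ℝ) => (q.1, q.1 ^ 2 + (q.2 0 ^ 2 + q.2 1 ^ 2)))
      (by fun_prop)
  calc ∫⁻ x : E3, F (inner ℝ d x) (‖x‖ ^ 2)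
      = ∫⁻ p : Fin 3 → ℝ, F (p 0) (p 0 ^ 2 + (p 1 ^ 2 + p 2 ^ 2)) := by
        simp_rw [h1]
        exact hmp.lintegral_comp hmeas
    _ = ∫⁻ q : ℝ × (Fin 2 → ℝ), F q.1 (q.1 ^ 2 + (q.2 0 ^ 2 + q.2 1 ^ 2)) := by
        rw [← hsplit.lintegral_comp hmeas']
        rfl
    _ = ∫⁻ z, ∫⁻ y : Fin 2 → ℝ, F z (z ^ 2 + (y 0 ^ 2 + y 1 ^ 2)) := by
        rw [Measure.volume_eq_prod, lintegral_prod _ hmeas'.aemeasurable]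
    _ = ∫⁻ z, ENNReal.ofReal Real.pi * ∫⁻ w in Set.Ici (z ^ 2), F z w := by
        refine lintegral_congr fun z => ?_
        have hFz : Measurable (F z) := hF.comp (f := fun w => (z, w)) (by fun_prop)
        rw [← lintegral_map (f := fun s => F z (z ^ 2 + s))
          (g := fun y : Fin 2 → ℝ => y 0 ^ 2 + y 1 ^ 2) (hFz.comp (by fun_prop)) (by fun_prop),
          map_volume_sq_add_sq, lintegral_smul_measure, smul_eq_mul,
          ← lintegral_indicator measurableSet_Ici, ← lintegral_indicator measurableSet_Ici,
          ← lintegral_add_left_eq_self ((Set.Ici (z ^ 2)).indicator (F z)) (z ^ 2)]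
        congr 1
        refine lintegral_congr fun s => ?_
        simp [Set.indicator_apply]
    _ = _ := by
        rw [lintegral_const_mul' _ _ ENNReal.ofReal_ne_top]

-- `toSphere` is three times the volume of the cone over the set. In the coordinates `(z, w)` the
-- cone is `z / √w ∈ T` with `0 < w < 1`, and its slice at fixed `w` is `T ∩ [-1, 1]` scaled by
-- `√w`, so the dependence on `T` factors out.
open scoped ENNReal Pointwise in
theorem toSphere_inner_preimage {d : E3} (hd : ‖d‖ = 1) {T : Set ℝ} (hT : MeasurableSet T) :
    (volume : Measure E3).toSphere ((fun o : S2 => inner ℝ d (o : E3)) ⁻¹' T) =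
      (3 * (ENNReal.ofReal Real.pi * ∫⁻ w in Set.Ioo (0 : ℝ) 1, ENNReal.ofReal √w)) *
        volume (T ∩ Set.Icc (-1) 1) := by
  have hm : Measurable (fun o : S2 => inner ℝ d (o : E3)) := by fun_prop
  rw [Measure.toSphere_apply' _ (hm hT)]
  have hset : Set.Ioo (0 : ℝ) 1 • ((↑) '' ((fun o : S2 => inner ℝ d (o : E3)) ⁻¹' T) : Set E3) =
      {x | ‖x‖ ^ 2 ∈ Set.Ioo (0 : ℝ) 1 ∧ inner ℝ d x / √(‖x‖ ^ 2) ∈ T} := by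
    ext x
    simp only [Set.mem_smul, Set.mem_image, Set.mem_preimage, Subtype.exists, Set.mem_ofPred_eq,
      mem_sphere_zero_iff_norm]
    constructor
    · rintro ⟨r, hr, _, ⟨o, ho, hoT, rfl⟩, rfl⟩
      have hn : ‖r • o‖ = r := by rw [norm_smul, ho, mul_one, Real.norm_of_nonneg hr.1.le]
      rw [hn, Real.sqrt_sq hr.1.le, inner_smul_right, mul_div_cancel_left₀ _ hr.1.ne']
      exact ⟨⟨pow_pos hr.1 2, pow_lt_one₀ hr.1.le hr.2 two_ne_zero⟩, hoT⟩
    · rintro ⟨⟨h0, h1⟩, hxT⟩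
      have hx : 0 < ‖x‖ := by
        rcases (norm_nonneg x).eq_or_lt with h | h
        · rw [← h] at h0; norm_num at h0
        · exact h
      rw [Real.sqrt_sq hx.le] at hxT
      refine ⟨‖x‖, ⟨hx, (sq_lt_one_iff₀ hx.le).1 h1⟩, ‖x‖⁻¹ • x, ⟨‖x‖⁻¹ • x, ?_, ?_, rfl⟩, ?_⟩
      · rw [norm_smul, norm_inv, norm_norm, inv_mul_cancel₀ hx.ne']
      · rwa [inner_smul_right, inv_mul_eq_div]
      · rw [smul_smul, mul_inv_cancel₀ hx.ne', one_smul]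
  let K : Set (ℝ × ℝ) := Prod.snd ⁻¹' Set.Ioo (0 : ℝ) 1 ∩ (fun p => p.1 / √p.2) ⁻¹' T
  have hK : MeasurableSet K :=
    (measurable_snd measurableSet_Ioo).inter
      ((measurable_fst.div (Real.continuous_sqrt.measurable.comp measurable_snd)) hT)
  let F : ℝ → ℝ → ℝ≥0∞ := fun z w => K.indicator 1 (z, w)
  have hF : Measurable (Function.uncurry F) := measurable_one.indicator hK
  have hvol : volume {x : E3 | ‖x‖ ^ 2 ∈ Set.Ioo (0 : ℝ) 1 ∧ inner ℝ d x / √(‖x‖ ^ 2) ∈ T} =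
      ∫⁻ x : E3, F (inner ℝ d x) (‖x‖ ^ 2) := by
    have hmx : Measurable (fun x : E3 => ((inner ℝ d x : ℝ), ‖x‖ ^ 2)) := by fun_prop
    have hpre : {x : E3 | ‖x‖ ^ 2 ∈ Set.Ioo (0 : ℝ) 1 ∧ inner ℝ d x / √(‖x‖ ^ 2) ∈ T} =
        (fun x : E3 => ((inner ℝ d x : ℝ), ‖x‖ ^ 2)) ⁻¹' K := by
      ext x; simp [K]
    rw [hpre, ← lintegral_indicator_one (hmx hK)]
    rfl
  rw [hset, hvol, lintegral_inner_norm_sq hd hF]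
  have hswap : ∫⁻ z, ∫⁻ w in Set.Ici (z ^ 2), F z w =
      (∫⁻ w in Set.Ioo (0 : ℝ) 1, ENNReal.ofReal √w) * volume (T ∩ Set.Icc (-1) 1) := by
    simp_rw [← lintegral_indicator measurableSet_Ici]
    rw [lintegral_lintegral_swap, ← lintegral_mul_const _ (by fun_prop),
      ← lintegral_indicator measurableSet_Ioo]
    · refine lintegral_congr fun w => ?_
      by_cases hw : w ∈ Set.Ioo (0 : ℝ) 1
      · have hs : 0 < √w := Real.sqrt_pos.2 hw.1
        rw [Set.indicator_of_mem hw, ← lintegral_indicator_one (hT.inter measurableSet_Icc)]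
        have hG : Measurable ((T ∩ Set.Icc (-1) 1).indicator (1 : ℝ → ℝ≥0∞)) :=
          measurable_one.indicator (hT.inter measurableSet_Icc)
        have h2 := lintegral_comp_const_mul (inv_pos.2 hs) hG
        rw [inv_inv] at h2
        rw [← h2]
        refine lintegral_congr fun z => ?_
        have hiff : z ^ 2 ≤ w ↔ (√w)⁻¹ * z ∈ Set.Icc (-1 : ℝ) 1 := by
          rw [inv_mul_eq_div, Set.mem_Icc, le_div_iff₀ hs, div_le_iff₀ hs, neg_one_mul, one_mul,
            ← abs_le]
          exact ⟨Real.abs_le_sqrt, fun h => by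
            rw [← Real.sq_sqrt hw.1.le, ← sq_abs]; gcongr⟩
        classical
        simp only [F, K, Set.indicator_apply, Set.mem_Ici, Set.mem_preimage, hiff, hw, true_and,
          Set.mem_inter_iff, inv_mul_eq_div, Pi.one_apply]
        split_ifs <;> tauto
      · rw [Set.indicator_of_notMem hw]
        have hF0 : ∀ z, F z w = 0 := fun z =>
          Set.indicator_of_notMem (s := K) (a := (z, w)) (fun h => hw h.1) _
        simp [hF0, Set.indicator_apply]
    · refine Measurable.aemeasurable ?_
      have : Function.uncurry (fun z w => (Set.Ici (z ^ 2)).indicator (fun w => F z w) w) =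
          {p : ℝ × ℝ | p.1 ^ 2 ≤ p.2}.indicator (Function.uncurry F) := by
        ext ⟨z, w⟩
        simp [Set.indicator_apply, Function.uncurry]
      rw [this]
      exact hF.indicator (measurableSet_le (by fun_prop) (by fun_prop))
  rw [hswap]
  simp [mul_assoc]

instance : IsProbabilityMeasure uniformSphere := by
  constructor
  rw [uniformSphere, Measure.smul_apply, smul_eq_mul]
  exact ENNReal.inv_mul_cancel (by simp [Real.pi_pos]) (measure_ne_top _ _)

/-- **Archimedes' hat-box theorem**: the coordinate of a uniform point of the sphere along a fixed
axis is uniform on `[-1, 1]`. -/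
theorem uniformSphere_map_inner {d : E3} (hd : ‖d‖ = 1) :
    uniformSphere.map (fun o : S2 => inner ℝ d (o : E3)) =
      (2⁻¹ : ENNReal) • volume.restrict (Set.Icc (-1 : ℝ) 1) := by
  have hm : Measurable (fun o : S2 => inner ℝ d (o : E3)) := by fun_prop
  obtain ⟨κ, hκ⟩ : ∃ κ : ENNReal, uniformSphere.map (fun o : S2 => inner ℝ d (o : E3)) =
      κ • volume.restrict (Set.Icc (-1 : ℝ) 1) := by
    refine ⟨((volume : Measure E3).toSphere Set.univ)⁻¹ *
      (3 * (ENNReal.ofReal Real.pi * ∫⁻ w in Set.Ioo (0 : ℝ) 1, ENNReal.ofReal √w)),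
      Measure.ext fun T hT => ?_⟩
    rw [Measure.map_apply hm hT, uniformSphere, Measure.smul_apply, toSphere_inner_preimage hd hT,
      smul_eq_mul, ← mul_assoc, Measure.smul_apply, Measure.restrict_apply hT, smul_eq_mul]
  -- The constant is found from the total mass 1, so the integral of `√w` and the area of the sphere
  -- need not be evaluated.
  have h1 : κ * 2 = 1 := by
    have h := congrArg (fun μ : Measure ℝ => μ Set.univ) hκ
    simp only [Measure.map_apply hm MeasurableSet.univ, Set.preimage_univ, measure_univ,
      Measure.smul_apply, Measure.restrict_apply_univ, Real.volume_Icc, smul_eq_mul] at h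
    rw [h]; norm_num
  rw [hκ, ENNReal.eq_inv_of_mul_eq_one_left h1]

/-! ### The alignment factor as a mixture of uniform laws -/

/-- The norm of the scaled field as a function of the cosine of the angle between transmitter axis
and direction. -/
noncomputable def Region.gain : Region → ℝ → ℝ
  | .near, u => √(1 + 3 * u ^ 2) / 2
  | .far, u => √(1 - u ^ 2)

theorem Region.continuous_gain (R : Region) : Continuous R.gain := by
  cases R <;> unfold Region.gain <;> fun_prop

theorem Region.norm_fieldVec (R : Region) {d o : E3} (hd : ‖d‖ = 1) (ho : ‖o‖ = 1) :
    ‖R.fieldVec d o‖ = R.gain (inner ℝ d o) := by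
  have hdd : inner ℝ d d = (1 : ℝ) := by rw [real_inner_self_eq_norm_sq, hd]; norm_num
  have hoo : inner ℝ o o = (1 : ℝ) := by rw [real_inner_self_eq_norm_sq, ho]; norm_num
  have hod : inner ℝ o d = inner ℝ d o := real_inner_comm _ _
  cases R
  · rw [Region.gain, @norm_eq_sqrt_real_inner E3, eq_div_iff two_ne_zero]
    rw [← Real.sqrt_sq (zero_le_two (α := ℝ)), ← Real.sqrt_mul' _ (by positivity)]
    congr 1
    simp only [Region.fieldVec, inner_smul_left, inner_smul_right, inner_sub_left, inner_sub_right,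
      hdd, hoo, hod, conj_trivial]
    ring
  · rw [Region.gain, @norm_eq_sqrt_real_inner E3]
    congr 1
    simp only [Region.fieldVec, inner_smul_left, inner_smul_right, inner_sub_left, inner_sub_right,
      hdd, hoo, hod, conj_trivial]
    ring

theorem Region.gain_pos (R : Region) {u : ℝ} (hu : u ∈ Set.Ioo (-1 : ℝ) 1) : 0 < R.gain u := by
  cases R
  · unfold Region.gain; positivity
  · refine Real.sqrt_pos.2 ?_
    nlinarith [hu.1, hu.2]

theorem Region.measurable_fieldVec (R : Region) (d : E3) : Measurable (R.fieldVec d) := by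
  cases R <;> unfold Region.fieldVec <;> fun_prop

/-- The density of the uniform distribution on `[-r, r]`. -/
noncomputable def uniformDensity (r x : ℝ) : ENNReal :=
  if |x| ≤ r then ENNReal.ofReal (2 * r)⁻¹ else 0

theorem measurable_uniformDensity : Measurable (Function.uncurry uniformDensity) := by
  refine Measurable.ite (measurableSet_le (by fun_prop) (by fun_prop)) (by fun_prop) (by fun_prop)

theorem uniformSphere_map_inner_right {v : E3} (hv : v ≠ 0) :
    uniformSphere.map (fun o : S2 => inner ℝ (o : E3) v) =
      volume.withDensity (uniformDensity ‖v‖) := by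
  have hr : 0 < ‖v‖ := norm_pos_iff.2 hv
  set r := ‖v‖ with hrdef
  have hd : ‖r⁻¹ • v‖ = 1 := by
    rw [norm_smul, norm_inv, hrdef, norm_norm, inv_mul_cancel₀ (norm_ne_zero_iff.2 hv)]
  have hfun : (fun o : S2 => inner ℝ (o : E3) v) =
      (fun t => r * t) ∘ (fun o : S2 => inner ℝ (r⁻¹ • v) (o : E3)) := by
    ext o
    simp only [Function.comp_apply, inner_smul_left, conj_trivial]
    rw [mul_inv_cancel_left₀ hr.ne', real_inner_comm]
  rw [hfun, ← Measure.map_map (by fun_prop) (by fun_prop), uniformSphere_map_inner hd]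
  ext s hs
  have hG : Measurable ((s ∩ Set.Icc (-r) r).indicator (1 : ℝ → ENNReal)) :=
    measurable_one.indicator (hs.inter measurableSet_Icc)
  have hpre : MeasurableSet ((fun t => r * t) ⁻¹' s) := (measurable_const_mul r) hs
  have hD : uniformDensity r = (Set.Icc (-r) r).indicator fun _ => ENNReal.ofReal (2 * r)⁻¹ := by
    ext x
    simp only [uniformDensity, Set.indicator_apply, Set.mem_Icc, abs_le]
  rw [Measure.map_apply (by fun_prop) hs, Measure.smul_apply,
    Measure.restrict_apply hpre, withDensity_apply _ hs, hD,
    lintegral_indicator measurableSet_Icc, setLIntegral_const,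
    Measure.restrict_apply measurableSet_Icc, smul_eq_mul, mul_inv, ENNReal.ofReal_mul (by norm_num),
    ENNReal.ofReal_inv_of_pos two_pos, ENNReal.ofReal_ofNat, mul_assoc, Set.inter_comm _ s,
    ← lintegral_indicator_one (hs.inter measurableSet_Icc), ← lintegral_comp_const_mul hr hG,
    ← lintegral_indicator_one (hpre.inter measurableSet_Icc)]
  congr 1
  refine lintegral_congr fun t => ?_
  have hiff : t ∈ Set.Icc (-1 : ℝ) 1 ↔ r * t ∈ Set.Icc (-r) r := by
    simp only [Set.mem_Icc]
    constructor
    · rintro ⟨h1, h2⟩; constructor <;> nlinarith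
    · rintro ⟨h1, h2⟩; constructor <;> nlinarith
  classical
  simp only [Set.indicator_apply, Set.mem_inter_iff, Set.mem_preimage, hiff, Pi.one_apply]

/-- Condition on the transmitter axis, apply the scaled hat-box theorem to the receiver axis, then
apply the hat-box theorem again to the cosine between transmitter axis and `d`. -/
theorem Region.map_alignment (R : Region) (d : S2) :
    (uniformSphere.prod uniformSphere).map (fun p : S2 × S2 => R.alignment d p.1 p.2) =
      volume.withDensity (fun x => 2⁻¹ * ∫⁻ u in Set.Icc (-1 : ℝ) 1, uniformDensity (R.gain u) x) := by
  have hd : ‖(d : E3)‖ = 1 := by simp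
  have hmd : Measurable (fun o : S2 => inner ℝ (d : E3) (o : E3)) := by fun_prop
  have hmv : Measurable (fun o : S2 => R.fieldVec d (o : E3)) :=
    (R.measurable_fieldVec d).comp measurable_subtype_coe
  have hmJ : Measurable (fun p : S2 × S2 => R.alignment d p.1 p.2) := by
    unfold Region.alignment
    exact (measurable_subtype_coe.comp measurable_snd).inner (hmv.comp measurable_fst)
  have hmg : Measurable R.gain := R.continuous_gain.measurable
  -- The far field vanishes when the axis is parallel to `d`, where the conditional law is a point
  -- mass; these two poles are null.
  have hae : ∀ᵐ o : S2 ∂uniformSphere, R.fieldVec d (o : E3) ≠ 0 := by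
    have h1 : ∀ᵐ u ∂(uniformSphere.map (fun o : S2 => inner ℝ (d : E3) (o : E3))),
        u ∈ Set.Ioo (-1 : ℝ) 1 := by
      rw [uniformSphere_map_inner hd]
      refine Measure.ae_smul_measure ?_ _
      rw [← restrict_Ioo_eq_restrict_Icc]
      exact ae_restrict_mem measurableSet_Ioo
    filter_upwards [ae_of_ae_map hmd.aemeasurable h1] with o ho h0
    have := R.gain_pos ho
    rw [← R.norm_fieldVec hd (by simp), h0, norm_zero] at this
    exact this.false
  ext s hs
  rw [Measure.map_apply hmJ hs, Measure.prod_apply (hmJ hs), withDensity_apply _ hs]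
  calc ∫⁻ o, uniformSphere (Prod.mk o ⁻¹' ((fun p : S2 × S2 => R.alignment d p.1 p.2) ⁻¹' s))
        ∂uniformSphere
      = ∫⁻ o : S2, (∫⁻ x in s, uniformDensity (R.gain (inner ℝ (d : E3) (o : E3))) x)
          ∂uniformSphere := by
        refine lintegral_congr_ae ?_
        filter_upwards [hae] with o ho
        rw [← R.norm_fieldVec hd (by simp), ← withDensity_apply _ hs,
          ← uniformSphere_map_inner_right ho, Measure.map_apply (by fun_prop) hs]
        rfl
    _ = ∫⁻ u, (∫⁻ x in s, uniformDensity (R.gain u) x)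
          ∂(uniformSphere.map (fun o : S2 => inner ℝ (d : E3) (o : E3))) := by
        rw [lintegral_map _ hmd]
        exact Measurable.lintegral_prod_right'
          (f := fun p : ℝ × ℝ => uniformDensity (R.gain p.1) p.2)
          (measurable_uniformDensity.comp (f := fun p : ℝ × ℝ => (R.gain p.1, p.2))
            (by fun_prop))
    _ = _ := by
        rw [uniformSphere_map_inner hd, lintegral_smul_measure, lintegral_lintegral_swap,
          lintegral_const_mul' _ _ (by norm_num), smul_eq_mul]
        exact (measurable_uniformDensity.comp (f := fun p : ℝ × ℝ => (R.gain p.1, p.2))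
            (by fun_prop)).aemeasurable

/-! ### Closed form of the mixture density -/

theorem lintegral_Icc_of_hasDerivAt {F f : ℝ → ℝ} {a b : ℝ} (hab : a ≤ b)
    (hF : ∀ x ∈ Set.Icc a b, HasDerivAt F (f x) x) (hf : ContinuousOn f (Set.Icc a b))
    (hpos : ∀ x ∈ Set.Icc a b, 0 ≤ f x) :
    ∫⁻ x in Set.Icc a b, ENNReal.ofReal (f x) = ENNReal.ofReal (F b - F a) := by
  rw [← Set.uIcc_of_le hab] at hF
  have hi := hf.integrableOn_Icc (μ := volume)
  rw [← intervalIntegral.integral_eq_sub_of_hasDerivAt hF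
    (ContinuousOn.intervalIntegrable (by rwa [Set.uIcc_of_le hab])),
    intervalIntegral.integral_of_le hab, ← integral_Icc_eq_integral_Ioc,
    ofReal_integral_eq_lintegral_ofReal hi]
  exact (ae_restrict_mem measurableSet_Icc).mono hpos

theorem lintegral_uniformDensity_comp {S : Set ℝ} {g : ℝ → ℝ} {x : ℝ} {A : Set ℝ}
    (hS : MeasurableSet S) (hA : MeasurableSet A) (hSA : ∀ u, u ∈ A ↔ u ∈ S ∧ |x| ≤ g u) :
    ∫⁻ u in S, uniformDensity (g u) x = ∫⁻ u in A, ENNReal.ofReal (2 * g u)⁻¹ := by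
  classical
  rw [← lintegral_indicator hS, ← lintegral_indicator hA]
  refine lintegral_congr fun u => ?_
  simp only [Set.indicator_apply, uniformDensity, hSA]
  split_ifs <;> tauto

theorem arsinh_sqrt_sq_sub_one {y : ℝ} (hy : 1 ≤ y) : Real.arsinh √(y ^ 2 - 1) = Real.arcosh y := by
  rw [← Real.sinh_arcosh hy, Real.arsinh_sinh]

theorem lintegral_gain_near {a b : ℝ} (hab : a ≤ b) :
    ∫⁻ u in Set.Icc a b, ENNReal.ofReal (2 * Region.near.gain u)⁻¹ =
      ENNReal.ofReal (Real.arsinh (√3 * b) / √3 - Real.arsinh (√3 * a) / √3) := by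
  have h3 : (√3 : ℝ) ≠ 0 := by positivity
  have hg : ∀ u : ℝ, 0 < 2 * Region.near.gain u := fun u => by unfold Region.gain; positivity
  refine lintegral_Icc_of_hasDerivAt (F := fun u => Real.arsinh (√3 * u) / √3) hab
    (fun u _ => ?_) ?_ (fun u _ => (inv_pos.2 (hg u)).le)
  · have h := ((hasDerivAt_id u).const_mul √3).arsinh.div_const √3
    refine h.congr_deriv ?_
    simp only [Region.gain, id, smul_eq_mul, mul_pow, mul_one]
    rw [Real.sq_sqrt (by norm_num : (0 : ℝ) ≤ 3)]
    field_simp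
  · exact ((Region.near.continuous_gain.const_mul 2).inv₀ fun u => (hg u).ne').continuousOn

theorem lintegral_gain_far {c : ℝ} (hc0 : 0 ≤ c) (hc : c < 1) :
    ∫⁻ u in Set.Icc (-c) c, ENNReal.ofReal (2 * Region.far.gain u)⁻¹ =
      ENNReal.ofReal (Real.arcsin c) := by
  have hg : ∀ u ∈ Set.Icc (-c) c, 0 < 2 * Region.far.gain u := fun u hu =>
    mul_pos two_pos (Region.far.gain_pos ⟨by linarith [hu.1], by linarith [hu.2]⟩)
  refine (lintegral_Icc_of_hasDerivAt (F := fun u => Real.arcsin u / 2) (by linarith)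
    (fun u hu => ?_) ?_ (fun u hu => (inv_pos.2 (hg u hu)).le)).trans ?_
  · have h := (Real.hasDerivAt_arcsin (x := u) (by linarith [hu.1] : -1 < u).ne'
      (by linarith [hu.2] : u < 1).ne).div_const 2
    refine h.congr_deriv ?_
    simp only [Region.gain, mul_inv]
    ring
  · exact (Region.far.continuous_gain.const_mul 2).continuousOn.inv₀ fun u hu => (hg u hu).ne'
  · rw [Real.arcsin_neg]; ring_nf

/-- The domain of integration is the set of `u` whose gain reaches `|x|`: all of `[-1, 1]`, two
outer intervals or nothing in the near field, a central interval or nothing in the far field. At `x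
= 0` the far-field integrand is singular at both ends of the domain; the excluded points form a null
set. -/
theorem Region.lintegral_uniformDensity_gain (R : Region) {x : ℝ} (h0 : x ≠ 0) (h1 : |x| ≠ 1) :
    2⁻¹ * ∫⁻ u in Set.Icc (-1 : ℝ) 1, uniformDensity (R.gain u) x = ENNReal.ofReal (R.pdf x) := by
  have hhalf : ∀ y : ℝ, 2⁻¹ * ENNReal.ofReal y = ENNReal.ofReal (2⁻¹ * y) := fun y => by
    rw [ENNReal.ofReal_mul (by norm_num), ENNReal.ofReal_inv_of_pos two_pos, ENNReal.ofReal_ofNat]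
  have hx0 : 0 < |x| := abs_pos.2 h0
  have hsq : |x| ^ 2 = x ^ 2 := sq_abs x
  have h3 : (√3 : ℝ) ^ 2 = 3 := Real.sq_sqrt (by norm_num)
  have h3p : (0 : ℝ) < √3 := by positivity
  have hac : 0 < Real.arcosh 2 := Real.arcosh_pos (by norm_num)
  have hs2 : Real.arsinh √3 = Real.arcosh 2 := by
    rw [← arsinh_sqrt_sq_sub_one one_le_two]; norm_num
  cases R
  · rcases le_or_gt |x| (1 / 2) with hx | hx
    · rw [lintegral_uniformDensity_comp (A := Set.Icc (-1) 1) measurableSet_Icc measurableSet_Icc,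
        lintegral_gain_near (by norm_num), hhalf]
      · congr 1
        simp only [Region.pdf, betaBarNear, if_pos hx, mul_one, mul_neg, Real.arsinh_neg, hs2]
        field_simp
        ring
      · intro u
        refine ⟨fun h => ⟨h, hx.trans ?_⟩, fun h => h.1⟩
        have : 1 ≤ √(1 + 3 * u ^ 2) := Real.one_le_sqrt.2 (by nlinarith [sq_nonneg u])
        simp only [Region.gain]; linarith
    · rcases lt_or_gt_of_ne h1 with hx1 | hx1
      -- The positive solution of `Region.near.gain c = |x|`.
      · set c := √((2 * |x|) ^ 2 - 1) / √3 with hc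
        have hy : 0 < (2 * |x|) ^ 2 - 1 := by nlinarith
        have hc0 : 0 < c := div_pos (Real.sqrt_pos.2 hy) h3p
        have hcsq : 3 * c ^ 2 = (2 * |x|) ^ 2 - 1 := by
          rw [hc, div_pow, h3, Real.sq_sqrt hy.le]; ring
        have hc1 : c ≤ 1 := by nlinarith
        have hsc : Real.arsinh (√3 * c) = Real.arcosh (2 * |x|) := by
          rw [hc, mul_div_cancel₀ _ h3p.ne', arsinh_sqrt_sq_sub_one (by linarith)]
        have hle : Real.arcosh (2 * |x|) ≤ Real.arcosh 2 :=
          (Real.arcosh_le_arcosh (by linarith) two_pos).2 (by linarith)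
        rw [lintegral_uniformDensity_comp (A := Set.Icc (-1) (-c) ∪ Set.Icc c 1) measurableSet_Icc
          (measurableSet_Icc.union measurableSet_Icc), lintegral_union measurableSet_Icc,
          lintegral_gain_near (by linarith), lintegral_gain_near hc1, ← ENNReal.ofReal_add, hhalf]
        · congr 1
          simp only [Region.pdf, betaBarNear, if_neg hx.not_ge, if_pos hx1, mul_one, mul_neg,
            Real.arsinh_neg, hs2, hsc]
          field_simp
          ring
        · simp only [mul_neg, mul_one, Real.arsinh_neg, hs2, hsc, neg_div, sub_neg_eq_add]
          rw [neg_add_eq_sub, sub_nonneg]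
          gcongr
        · simp only [mul_one, hs2, hsc]
          rw [sub_nonneg]
          gcongr
        · rw [Set.disjoint_left]
          rintro u ⟨_, h⟩ ⟨h', _⟩
          linarith
        · intro u
          have hgu : |x| ≤ Region.near.gain u ↔ c ≤ |u| := by
            rw [Region.gain, le_div_iff₀ two_pos, Real.le_sqrt' (by linarith),
              show c ≤ |u| ↔ c ^ 2 ≤ u ^ 2 by rw [sq_le_sq, abs_of_pos hc0]]
            constructor <;> intro h <;> nlinarith
          rw [hgu, le_abs, Set.mem_union, Set.mem_Icc, Set.mem_Icc, Set.mem_Icc]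
          constructor
          · rintro (⟨h, h'⟩ | ⟨h, h'⟩)
            · exact ⟨⟨h, by linarith⟩, Or.inr (by linarith)⟩
            · exact ⟨⟨by linarith, h'⟩, Or.inl h⟩
          · rintro ⟨⟨h, h'⟩, h'' | h''⟩
            · exact Or.inr ⟨h'', h'⟩
            · exact Or.inl ⟨h, by linarith⟩
      · rw [lintegral_uniformDensity_comp (A := ∅) measurableSet_Icc MeasurableSet.empty]
        · simp only [Region.pdf, if_neg hx.not_ge, if_neg hx1.le.not_gt]
          simp
        · intro u
          simp only [Set.mem_empty_iff_false, Set.mem_Icc, false_iff, not_and, not_le]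
          intro hu
          refine lt_of_le_of_lt ?_ hx1
          rw [Region.gain, div_le_one two_pos, Real.sqrt_le_left zero_le_two]
          nlinarith [hu.1, hu.2]
  · rcases lt_or_gt_of_ne h1 with hx1 | hx1
    · have hx2 : 0 < 1 - x ^ 2 := by nlinarith
      have hc : √(1 - x ^ 2) < 1 := by
        rw [Real.sqrt_lt' one_pos]; nlinarith
      rw [lintegral_uniformDensity_comp (A := Set.Icc (-√(1 - x ^ 2)) √(1 - x ^ 2))
        measurableSet_Icc measurableSet_Icc, lintegral_gain_far (Real.sqrt_nonneg _) hc, hhalf]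
      · congr 1
        simp only [Region.pdf]
        -- For nonnegative `y`, `arcsin √(1 - y²) = arccos y = π / 2 - arcsin y`.
        rw [Set.indicator_of_mem (s := Set.Icc (-1 : ℝ) 1) (abs_le.1 hx1.le), ← hsq, ← Real.arccos_eq_arcsin hx0.le,
          Real.arccos]
        ring
      · intro u
        rw [Region.gain, Real.le_sqrt' hx0, hsq, Set.mem_Icc, Set.mem_Icc, ← abs_le, ← abs_le, Real.le_sqrt (abs_nonneg u), sq_abs]
        constructor
        · intro h
          exact ⟨abs_le_one_iff_mul_self_le_one.2 (by nlinarith), by linarith⟩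
        · rintro ⟨-, h⟩
          linarith
        · exact hx2.le
    · rw [lintegral_uniformDensity_comp (A := ∅) measurableSet_Icc MeasurableSet.empty]
      · simp only [Region.pdf]
        rw [Set.indicator_of_notMem (s := Set.Icc (-1 : ℝ) 1) (fun h => (abs_le.2 h).not_gt hx1)]
        simp
      · intro u
        simp only [Set.mem_empty_iff_false, Set.mem_Icc, false_iff, not_and, not_le]
        intro hu
        refine lt_of_le_of_lt ?_ hx1
        rw [Region.gain, Real.sqrt_le_left zero_le_one]
        nlinarith [sq_nonneg u]

theorem Region.map_alignment_eq_withDensity_pdf (R : Region) (d : S2) :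
    (uniformSphere.prod uniformSphere).map (fun p : S2 × S2 => R.alignment d p.1 p.2) =
      volume.withDensity (fun x => ENNReal.ofReal (R.pdf x)) := by
  rw [R.map_alignment d]
  refine withDensity_congr_ae ?_
  have hfin : ({0, 1, -1} : Set ℝ).Finite := by simp
  filter_upwards [hfin.measure_zero volume |> compl_mem_ae_iff.2] with x hx
  simp only [Set.mem_compl_iff, Set.mem_insert_iff, Set.mem_singleton_iff, not_or] at hx
  refine R.lintegral_uniformDensity_gain hx.1 fun h => ?_
  rcases eq_or_eq_neg_of_abs_eq h with h | h
  · exact hx.2.1 h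
  · exact hx.2.2 h

/-! ### Conditional error probability of BPSK -/

/-- The tail function of the standard normal distribution. -/
noncomputable def gaussianTail (t : ℝ) : ℝ := (gaussianReal 0 1).real (Set.Ioi t)

theorem gaussianReal_prod_map_linear (a b : ℝ) (v : NNReal) :
    ((gaussianReal 0 v).prod (gaussianReal 0 v)).map (fun z : ℝ × ℝ => a * z.1 + b * z.2) =
      gaussianReal 0 (NNReal.mk (a ^ 2 + b ^ 2) (by positivity) * v) := by
  have h : (fun z : ℝ × ℝ => a * z.1 + b * z.2) =
      (fun z : ℝ × ℝ => z.1 + z.2) ∘ Prod.map (fun x => a * x) (fun x => b * x) := rfl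
  rw [h, ← Measure.map_map (by fun_prop) (by fun_prop), ← Measure.map_prod_map _ _ (by fun_prop)
    (by fun_prop), gaussianReal_map_const_mul, gaussianReal_map_const_mul]
  have h2 := gaussianReal_conv_gaussianReal (m₁ := a * 0) (m₂ := b * 0)
    (v₁ := NNReal.mk (a ^ 2) (sq_nonneg a) * v) (v₂ := NNReal.mk (b ^ 2) (sq_nonneg b) * v)
  rw [Measure.conv] at h2
  rw [h2, mul_zero, mul_zero, add_zero, ← add_mul]
  rfl

theorem complexNoise_map_re_conj_mul {pN : ℝ} (hN : 0 < pN) (h : ℂ) :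
    (complexNoise pN).map (fun w : ℂ => ((starRingEnd ℂ) h * w).re) =
      (gaussianReal 0 1).map (fun x => (‖h‖ * √(pN / 2)) * x) := by
  have hm : Measurable (fun z : ℝ × ℝ => (⟨z.1, z.2⟩ : ℂ)) :=
    Complex.measurableEquivRealProd.symm.measurable
  rw [complexNoise, Measure.map_map (by fun_prop) hm, gaussianReal_map_const_mul]
  have hc : (fun w : ℂ => ((starRingEnd ℂ) h * w).re) ∘ (fun z : ℝ × ℝ => (⟨z.1, z.2⟩ : ℂ)) =
      fun z : ℝ × ℝ => h.re * z.1 + h.im * z.2 := by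
    ext z
    simp [Complex.mul_re]
  rw [hc, gaussianReal_prod_map_linear, mul_zero, mul_one]
  congr 1
  ext
  rw [NNReal.coe_mul, Real.coe_toNNReal _ (by positivity)]
  simp only [NNReal.coe_mk]
  rw [mul_pow, Real.sq_sqrt (by positivity), ← Complex.normSq_eq_norm_sq, Complex.normSq_apply]
  ring

theorem gaussianReal_Iio_neg (t : ℝ) :
    (gaussianReal 0 1).real (Set.Iio (-t)) = gaussianTail t := by
  have h := gaussianReal_map_neg (μ := 0) (v := 1)
  rw [neg_zero] at h
  have hpre : (fun x : ℝ => -x) ⁻¹' Set.Iio (-t) = Set.Ioi t := by ext; simp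
  rw [gaussianTail, ← h, map_measureReal_apply (by fun_prop) measurableSet_Iio, hpre, h]

theorem gaussianReal_Ici (t : ℝ) : (gaussianReal 0 1).real (Set.Ici t) = gaussianTail t := by
  have := nullSingletonClass_gaussianReal (μ := 0) one_ne_zero
  rw [gaussianTail, measureReal_def, measureReal_def, measure_congr Ioi_ae_eq_Ici]

/-- The decision statistic is `± ‖h‖² √pTx` plus a centred Gaussian of standard deviation `σ = ‖h‖
√(pN / 2)`. An error means that the noise crosses the threshold 0, which lies `t = √(2 SNR)`
standard deviations away. Ties are decided as `true`, hence one open and one closed half-line, of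
equal probability. -/
theorem bpskErrorProb_eq_gaussianTail {pTx pN : ℝ} (hT : 0 < pTx) (hN : 0 < pN) {h : ℂ}
    (hh : h ≠ 0) : bpskErrorProb pTx pN h = gaussianTail √(2 * (‖h‖ ^ 2 * pTx / pN)) := by
  have hn : 0 < ‖h‖ := norm_pos_iff.2 hh
  set σ := ‖h‖ * √(pN / 2) with hσ
  have hσ0 : 0 < σ := by positivity
  set t := √(2 * (‖h‖ ^ 2 * pTx / pN)) with ht
  have htσ : σ * t = ‖h‖ ^ 2 * √pTx := by
    have h1 : √(pN / 2) * t = ‖h‖ * √pTx := by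
      rw [ht, ← Real.sqrt_mul (by positivity), ← Real.sqrt_sq hn.le, ← Real.sqrt_mul (by positivity),
        Real.sqrt_sq hn.le]
      congr 1
      field_simp
    rw [hσ, mul_assoc, h1]; ring
  have hre : ∀ (s : ℝ) (w : ℂ), ((starRingEnd ℂ) h * (h * ((√pTx * s : ℝ) : ℂ) + w)).re =
      ‖h‖ ^ 2 * √pTx * s + ((starRingEnd ℂ) h * w).re := by
    intro s w
    rw [mul_add, Complex.add_re, ← mul_assoc, ← Complex.normSq_eq_conj_mul_self,
      ← Complex.ofReal_mul, Complex.ofReal_re, Complex.normSq_eq_norm_sq]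
    ring
  have hmw : Measurable (fun w : ℂ => ((starRingEnd ℂ) h * w).re) := by fun_prop
  have hlaw : ∀ s : Set ℝ, MeasurableSet s →
      (complexNoise pN).real ((fun w : ℂ => ((starRingEnd ℂ) h * w).re) ⁻¹' s) =
        (gaussianReal 0 1).real ((fun x => σ * x) ⁻¹' s) := by
    intro s hs
    rw [← map_measureReal_apply hmw hs, complexNoise_map_re_conj_mul hN h,
      map_measureReal_apply (by fun_prop) hs]
  have htrue : {w : ℂ | bpskDetect h (h * ((√pTx * bpskSymbol true : ℝ) : ℂ) + w) ≠ true} =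
      (fun w : ℂ => ((starRingEnd ℂ) h * w).re) ⁻¹' Set.Iio (-(σ * t)) := by
    ext w
    simp only [bpskDetect, hre, bpskSymbol, ne_eq, decide_eq_true_eq, not_le, Set.mem_preimage,
      Set.mem_Iio, htσ, Set.mem_ofPred_eq, if_true]
    constructor <;> intro h <;> linarith
  have hfalse : {w : ℂ | bpskDetect h (h * ((√pTx * bpskSymbol false : ℝ) : ℂ) + w) ≠ false} =
      (fun w : ℂ => ((starRingEnd ℂ) h * w).re) ⁻¹' Set.Ici (σ * t) := by
    ext w
    simp only [bpskDetect, hre, bpskSymbol, ne_eq, decide_eq_false_iff_not, not_not,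
      Set.mem_preimage, Set.mem_Ici, htσ, Set.mem_ofPred_eq, Bool.false_eq_true, if_false]
    constructor <;> intro h <;> linarith
  have hp1 : (fun x => σ * x) ⁻¹' Set.Iio (-(σ * t)) = Set.Iio (-t) := by
    ext x
    rw [Set.mem_preimage, Set.mem_Iio, Set.mem_Iio, ← mul_neg, mul_lt_mul_iff_right₀ hσ0]
  have hp2 : (fun x => σ * x) ⁻¹' Set.Ici (σ * t) = Set.Ici t := by
    ext x
    rw [Set.mem_preimage, Set.mem_Ici, Set.mem_Ici, mul_le_mul_iff_right₀ hσ0]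
  rw [bpskErrorProb, Fintype.sum_bool, htrue, hfalse, hlaw _ measurableSet_Iio,
    hlaw _ measurableSet_Ici, hp1, hp2, gaussianReal_Iio_neg, gaussianReal_Ici]
  ring

/-! ### The integral of the Gaussian tail -/

theorem gaussianTail_nonneg (t : ℝ) : 0 ≤ gaussianTail t := measureReal_nonneg

theorem gaussianTail_pos (t : ℝ) : 0 < gaussianTail t := by
  refine ENNReal.toReal_pos (fun h => ?_) (measure_ne_top _ _)
  have := gaussianReal_absolutelyContinuous' 0 (one_ne_zero : (1 : NNReal) ≠ 0) h
  simp at this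

theorem antitone_gaussianTail : Antitone gaussianTail := fun _ _ h =>
  measureReal_mono (Set.Ioi_subset_Ioi h)

theorem measurable_gaussianTail : Measurable gaussianTail := antitone_gaussianTail.measurable

/-- `ENNReal.ofReal` cuts off negative `y`, so this is the mean of twice the positive part of a
standard normal variable. It follows from the antiderivative `-2φ` of `2 y φ(y)`, where `φ` is the
normal density. -/
theorem lintegral_two_mul_gaussianReal :
    ∫⁻ y, ENNReal.ofReal (2 * y) ∂gaussianReal 0 1 = ENNReal.ofReal √(2 / Real.pi) := by
  set g : ℝ → ℝ := fun y => -(2 * gaussianPDFReal 0 1 y) with hg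
  have hpdf : ∀ y, gaussianPDFReal 0 1 y = (√(2 * Real.pi))⁻¹ * Real.exp (-y ^ 2 / 2) := by
    intro y; simp [gaussianPDFReal]
  have hd : ∀ y : ℝ, HasDerivAt g (2 * y * gaussianPDFReal 0 1 y) y := by
    intro y
    have h1 : HasDerivAt (fun y : ℝ => -y ^ 2 / 2) (-y) y := by
      refine ((hasDerivAt_pow 2 y).neg.div_const 2).congr_deriv ?_
      norm_num
      ring
    have h2 := ((h1.exp.const_mul (√(2 * Real.pi))⁻¹).const_mul 2).neg
    simp only [hg, hpdf]
    refine h2.congr_deriv ?_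
    ring
  have hlim : Tendsto g atTop (𝓝 0) := by
    have h1 : Tendsto (fun y : ℝ => -y ^ 2 / 2) atTop atBot := by
      have : (fun y : ℝ => -y ^ 2 / 2) = fun y => -(y ^ 2 / 2) := by ext; ring
      rw [this]
      exact tendsto_neg_atTop_atBot.comp ((tendsto_pow_atTop two_ne_zero).atTop_div_const two_pos)
    have h2 := (((Real.tendsto_exp_atBot.comp h1).const_mul (√(2 * Real.pi))⁻¹).const_mul 2).neg
    simp only [mul_zero, neg_zero] at h2
    simpa only [hg, hpdf, Function.comp_def] using h2
  have hnn : ∀ y ∈ Set.Ioi (0 : ℝ), 0 ≤ 2 * y * gaussianPDFReal 0 1 y := fun y hy =>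
    mul_nonneg (mul_nonneg zero_le_two (le_of_lt hy)) (gaussianPDFReal_nonneg _ _ _)
  have hint := integral_Ioi_of_hasDerivAt_of_nonneg' (a := 0) (fun y _ => hd y) hnn hlim
  have hion := integrableOn_Ioi_deriv_of_nonneg' (a := 0) (fun y _ => hd y) hnn hlim
  have hval : (0 : ℝ) - g 0 = √(2 / Real.pi) := by
    simp only [hg, hpdf]
    rw [Real.sqrt_div zero_le_two, Real.sqrt_mul zero_le_two]
    have : √(2 : ℝ) * √2 = 2 := Real.mul_self_sqrt zero_le_two
    have hp : 0 < √Real.pi := Real.sqrt_pos.2 Real.pi_pos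
    norm_num
    field_simp
    nlinarith
  rw [← hval, ← hint, ofReal_integral_eq_lintegral_ofReal hion
    ((ae_restrict_mem measurableSet_Ioi).mono hnn), gaussianReal_of_var_ne_zero _ one_ne_zero,
    lintegral_withDensity_eq_lintegral_mul _ (measurable_gaussianPDF 0 1) (by fun_prop),
    ← lintegral_indicator measurableSet_Ioi]
  refine lintegral_congr fun y => ?_
  by_cases hy : y ∈ Set.Ioi (0 : ℝ)
  · rw [Set.indicator_of_mem hy, Pi.mul_apply, gaussianPDF, mul_comm,
      ← ENNReal.ofReal_mul (mul_nonneg zero_le_two (le_of_lt hy))]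
  · rw [Set.indicator_of_notMem hy, Pi.mul_apply, ENNReal.ofReal_of_nonpos (p := 2 * y), mul_zero]
    linarith [Set.notMem_Ioi.1 hy]

/-- Tonelli on the region `|x| < y`: the slice at fixed `x` has Gaussian mass equal to the tail, the
slice at fixed `y` has length twice the positive part of `y`. -/
theorem lintegral_gaussianTail_abs :
    ∫⁻ x, ENNReal.ofReal (gaussianTail |x|) = ENNReal.ofReal √(2 / Real.pi) := by
  have hS : MeasurableSet {p : ℝ × ℝ | |p.1| < p.2} :=
    measurableSet_lt (by fun_prop) (by fun_prop)
  have h1 : ∀ x : ℝ, ENNReal.ofReal (gaussianTail |x|) =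
      gaussianReal 0 1 (Prod.mk x ⁻¹' {p : ℝ × ℝ | |p.1| < p.2}) := by
    intro x
    rw [gaussianTail, ofReal_measureReal]
    rfl
  simp_rw [h1]
  rw [← Measure.prod_apply hS, Measure.prod_apply_symm hS, ← lintegral_two_mul_gaussianReal]
  refine lintegral_congr fun y => ?_
  have : (fun x : ℝ => (x, y)) ⁻¹' {p : ℝ × ℝ | |p.1| < p.2} = Set.Ioo (-y) y := by
    ext x; simp [abs_lt]
  rw [this, Real.volume_Ioo]
  congr 1
  ring

theorem integrable_gaussianTail_abs : Integrable (fun x : ℝ => gaussianTail |x|) := by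
  refine ⟨(measurable_gaussianTail.comp (by fun_prop)).aestronglyMeasurable, ?_⟩
  rw [hasFiniteIntegral_iff_ofReal (ae_of_all _ fun x => gaussianTail_nonneg _),
    lintegral_gaussianTail_abs]
  exact ENNReal.ofReal_lt_top

theorem integral_gaussianTail_abs : ∫ x : ℝ, gaussianTail |x| = √(2 / Real.pi) := by
  rw [integral_eq_lintegral_of_nonneg_ae (ae_of_all _ fun x => gaussianTail_nonneg _)
    integrable_gaussianTail_abs.aestronglyMeasurable, lintegral_gaussianTail_abs,
    ENNReal.toReal_ofReal (Real.sqrt_nonneg _)]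

/-! ### The density: maximum and continuity at 0, support -/

theorem betaBarNear_pos : 0 < betaBarNear :=
  div_pos (by positivity) (mul_pos two_pos (Real.arcosh_pos (by norm_num)))

theorem Region.pdf_zero_pos (R : Region) : 0 < R.pdf 0 := by
  cases R
  · have := betaBarNear_pos
    simp only [Region.pdf]
    rw [if_pos (by norm_num)]
    positivity
  · simp only [Region.pdf]
    rw [Set.indicator_of_mem (by norm_num)]
    simp [Real.pi_pos]

theorem Region.pdf_nonneg (R : Region) (x : ℝ) : 0 ≤ R.pdf x := by
  cases R
  · have hb := betaBarNear_pos
    have hac : 0 < Real.arcosh 2 := Real.arcosh_pos (by norm_num)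
    simp only [Region.pdf]
    refine mul_nonneg (by positivity) ?_
    split_ifs with h1 h2
    · exact zero_le_one
    · rw [sub_nonneg, div_le_one hac, Real.arcosh_le_arcosh (by linarith) two_pos]
      linarith
    · exact le_rfl
  · simp only [Region.pdf]
    refine Set.indicator_nonneg (fun y _ => ?_) x
    linarith [Real.arcsin_le_pi_div_two |y|]

theorem Region.pdf_le_pdf_zero (R : Region) (x : ℝ) : R.pdf x ≤ R.pdf 0 := by
  cases R
  · have hb := betaBarNear_pos
    have hac : 0 < Real.arcosh 2 := Real.arcosh_pos (by norm_num)
    simp only [Region.pdf]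
    refine mul_le_mul_of_nonneg_left ?_ (by positivity)
    rw [if_pos (by norm_num : |(0 : ℝ)| ≤ 1 / 2)]
    split_ifs with h1 h2
    · exact le_rfl
    · rw [sub_le_self_iff]
      exact div_nonneg (Real.arcosh_nonneg (by linarith)) hac.le
    · exact zero_le_one
  · simp only [Region.pdf]
    rw [Set.indicator_of_mem (by norm_num : (0 : ℝ) ∈ Set.Icc (-1 : ℝ) 1)]
    rw [abs_zero, Real.arcsin_zero]
    by_cases hx : x ∈ Set.Icc (-1 : ℝ) 1
    · rw [Set.indicator_of_mem hx]
      linarith [Real.arcsin_nonneg.2 (abs_nonneg x)]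
    · rw [Set.indicator_of_notMem hx]
      linarith [Real.pi_pos]

theorem Region.pdf_of_one_lt (R : Region) {x : ℝ} (hx : 1 < x) : R.pdf x = 0 := by
  have h : |x| = x := abs_of_pos (by linarith)
  cases R
  · simp only [Region.pdf]
    rw [if_neg (by rw [h]; linarith), if_neg (by rw [h]; linarith), mul_zero]
  · simp only [Region.pdf]
    rw [Set.indicator_of_notMem (fun hm => hx.not_ge hm.2)]

theorem measurable_arcosh : Measurable Real.arcosh := by
  unfold Real.arcosh
  fun_prop

theorem Region.measurable_pdf (R : Region) : Measurable R.pdf := by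
  have := measurable_arcosh
  cases R
  · unfold Region.pdf
    refine measurable_const.mul (Measurable.ite (measurableSet_le (by fun_prop) (by fun_prop))
      (by fun_prop) (Measurable.ite (measurableSet_lt (by fun_prop) (by fun_prop)) ?_ (by fun_prop)))
    fun_prop
  · unfold Region.pdf
    refine Measurable.indicator ?_ measurableSet_Icc
    exact (measurable_const.sub (Real.measurable_arcsin.comp (by fun_prop))).const_mul _

theorem Region.continuousAt_pdf_zero (R : Region) : ContinuousAt R.pdf 0 := by
  cases R
  · refine (continuousAt_const (y := 1 / (2 * betaBarNear))).congr ?_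
    filter_upwards [Metric.ball_mem_nhds (0 : ℝ) (by norm_num : (0 : ℝ) < 1 / 2)] with x hx
    rw [mem_ball_zero_iff, Real.norm_eq_abs] at hx
    simp only [Region.pdf, if_pos hx.le, mul_one]
  · have hc : Continuous fun x : ℝ => 1 / 2 * (Real.pi / 2 - Real.arcsin |x|) :=
      continuous_const.mul (continuous_const.sub (Real.continuous_arcsin.comp continuous_abs))
    refine hc.continuousAt.congr ?_
    filter_upwards [Icc_mem_nhds (by norm_num : (-1 : ℝ) < 0) one_pos] with x hx
    simp only [Region.pdf]
    rw [Set.indicator_of_mem hx]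

/-! ### The bound and its tightness -/

/-- The bit error rate as a function of the optimal signal-to-noise ratio. -/
noncomputable def Region.berAt (R : Region) (s : ℝ) : ℝ :=
  ∫ x, R.pdf x * gaussianTail (√(2 * s) * |x|)

theorem integrable_gaussianTail_mul_abs {k : ℝ} (hk : 0 < k) :
    Integrable fun x : ℝ => gaussianTail (k * |x|) := by
  have := integrable_gaussianTail_abs.comp_mul_left' hk.ne'
  simpa only [abs_mul, abs_of_pos hk] using this

theorem Region.integrable_pdf_mul_gaussianTail (R : Region) {k : ℝ} (hk : 0 < k) :
    Integrable fun x : ℝ => R.pdf x * gaussianTail (k * |x|) := by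
  refine (integrable_gaussianTail_mul_abs hk).bdd_mul (c := R.pdf 0)
    R.measurable_pdf.aestronglyMeasurable (ae_of_all _ fun x => ?_)
  rw [Real.norm_of_nonneg (R.pdf_nonneg x)]
  exact R.pdf_le_pdf_zero x

theorem integral_gaussianTail_mul_abs {k : ℝ} (hk : 0 < k) :
    ∫ x : ℝ, gaussianTail (k * |x|) = k⁻¹ * √(2 / Real.pi) := by
  have := Measure.integral_comp_mul_left (fun x : ℝ => gaussianTail |x|) k
  simp only [abs_mul, abs_of_pos hk, abs_inv, integral_gaussianTail_abs, smul_eq_mul] at this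
  exact this

theorem inv_sqrt_mul_sqrt_two_div_pi {s : ℝ} (hs : 0 < s) :
    (√(2 * s))⁻¹ * √(2 / Real.pi) = 1 / √(Real.pi * s) := by
  have := Real.pi_pos
  rw [← Real.sqrt_inv, ← Real.sqrt_mul (by positivity), one_div, ← Real.sqrt_inv]
  congr 1
  field_simp

theorem Region.berAt_lt (R : Region) {s : ℝ} (hs : 0 < s) :
    R.berAt s < R.pdf 0 / √(Real.pi * s) := by
  have hk : 0 < √(2 * s) := by positivity
  have hi1 := R.integrable_pdf_mul_gaussianTail hk
  have hi2 := (integrable_gaussianTail_mul_abs hk).const_mul (R.pdf 0)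
  have hb : R.pdf 0 / √(Real.pi * s) = ∫ x : ℝ, R.pdf 0 * gaussianTail (√(2 * s) * |x|) := by
    rw [integral_const_mul, integral_gaussianTail_mul_abs hk, inv_sqrt_mul_sqrt_two_div_pi hs]
    ring
  rw [hb, Region.berAt, ← sub_pos, ← integral_sub hi2 hi1, integral_pos_iff_support_of_nonneg]
  -- Strictness comes from `x > 1`, where the density vanishes but the Gaussian tail does not.
  · refine lt_of_lt_of_le ?_ (measure_mono (s := Set.Ioi (1 : ℝ)) fun x hx => ?_)
    · simp
    · rw [Function.mem_support, R.pdf_of_one_lt hx, zero_mul, sub_zero]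
      exact (mul_pos R.pdf_zero_pos (gaussianTail_pos _)).ne'
  · intro x
    simp only [Pi.zero_apply]
    rw [← sub_mul]
    exact mul_nonneg (sub_nonneg.2 (R.pdf_le_pdf_zero x)) (gaussianTail_nonneg _)
  · exact hi2.sub hi1

/-- Substituting `y = √(2 s) x` moves all dependence on `s` into the argument of the density, ready
for dominated convergence with the majorant `R.pdf 0 * gaussianTail |y|`. -/
theorem Region.berAt_div {R : Region} {s : ℝ} (hs : 0 < s) :
    R.berAt s / (R.pdf 0 / √(Real.pi * s)) =
      (∫ y, R.pdf ((√(2 * s))⁻¹ * y) * gaussianTail |y|) / (R.pdf 0 * √(2 / Real.pi)) := by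
  have hk : 0 < √(2 * s) := by positivity
  have h := Measure.integral_comp_mul_left
    (fun y : ℝ => R.pdf ((√(2 * s))⁻¹ * y) * gaussianTail |y|) √(2 * s)
  simp only [abs_mul, abs_of_pos hk, abs_inv, smul_eq_mul, inv_mul_cancel_left₀ hk.ne'] at h
  have hp := R.pdf_zero_pos
  have h2 : 0 < √(2 / Real.pi) := Real.sqrt_pos.2 (div_pos two_pos Real.pi_pos)
  rw [Region.berAt, h, div_eq_mul_one_div (R.pdf 0), ← inv_sqrt_mul_sqrt_two_div_pi hs]
  field_simp

theorem Region.tendsto_berAt_div (R : Region) :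
    Tendsto (fun s => R.berAt s / (R.pdf 0 / √(Real.pi * s))) atTop (𝓝 1) := by
  have hp := R.pdf_zero_pos
  have h2 : 0 < √(2 / Real.pi) := Real.sqrt_pos.2 (div_pos two_pos Real.pi_pos)
  have hk : Tendsto (fun s : ℝ => (√(2 * s))⁻¹) atTop (𝓝 0) :=
    tendsto_inv_atTop_zero.comp
      (Real.tendsto_sqrt_atTop.comp (tendsto_id.const_mul_atTop two_pos))
  have hlim : Tendsto (fun s => ∫ y, R.pdf ((√(2 * s))⁻¹ * y) * gaussianTail |y|) atTop
      (𝓝 (∫ y, R.pdf 0 * gaussianTail |y|)) := by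
    refine tendsto_integral_filter_of_dominated_convergence
      (fun y => R.pdf 0 * gaussianTail |y|) (Eventually.of_forall fun s => ?_)
      (Eventually.of_forall fun s => ae_of_all _ fun y => ?_)
      (integrable_gaussianTail_abs.const_mul _) (ae_of_all _ fun y => ?_)
    · exact ((R.measurable_pdf.comp (by fun_prop)).mul
        (measurable_gaussianTail.comp (by fun_prop))).aestronglyMeasurable
    · rw [Real.norm_of_nonneg (mul_nonneg (R.pdf_nonneg _) (gaussianTail_nonneg _))]
      exact mul_le_mul_of_nonneg_right (R.pdf_le_pdf_zero _) (gaussianTail_nonneg _)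
    · refine Tendsto.mul_const _ (R.continuousAt_pdf_zero.tendsto.comp ?_)
      simpa using hk.mul_const y
  rw [integral_const_mul, integral_gaussianTail_abs] at hlim
  have h := hlim.div_const (R.pdf 0 * √(2 / Real.pi))
  rw [div_self (by positivity)] at h
  refine h.congr' ?_
  filter_upwards [eventually_gt_atTop 0] with s hs
  exact (Region.berAt_div hs).symm

/-! ### From the random link to the integral over the density -/

theorem FadingLink.snrOpt_pos {Ω : Type*} [MeasurableSpace Ω] {P : Measure Ω} {J : Ω → ℝ}
    (L : FadingLink P J) : 0 < L.snrOpt := by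
  have h1 := norm_pos_iff.2 L.hOpt_ne_zero
  have h2 := L.pTx_pos
  have h3 := L.pN_pos
  unfold FadingLink.snrOpt
  positivity

theorem FadingLink.ber_eq_berAt {Ω : Type*} [MeasurableSpace Ω] {P : Measure Ω} {J : Ω → ℝ}
    {R : Region} (hJm : AEMeasurable J P)
    (hJ : P.map J = volume.withDensity (fun x => ENNReal.ofReal (R.pdf x)))
    (L : FadingLink P J) : L.ber = R.berAt L.snrOpt := by
  -- This makes `h ≠ 0` almost surely, so that the tail formula applies.
  have hJ0 : ∀ᵐ ω ∂P, J ω ≠ 0 := by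
    refine ae_of_ae_map (p := fun x => x ≠ 0) hJm ?_
    rw [hJ]
    exact (withDensity_absolutelyContinuous _ _).ae_le (Measure.ae_ne volume 0)
  have hber : L.ber = ∫ ω, gaussianTail (√(2 * L.snrOpt) * |J ω|) ∂P := by
    refine integral_congr_ae ?_
    filter_upwards [hJ0, L.sq_norm_h] with ω h0 hsq
    have hh : L.h ω ≠ 0 := by
      intro h
      rw [h, norm_zero, zero_pow two_ne_zero] at hsq
      have := norm_pos_iff.2 L.hOpt_ne_zero
      have : 0 < ‖L.hOpt‖ ^ 2 * J ω ^ 2 := by positivity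
      exact this.ne hsq
    rw [bpskErrorProb_eq_gaussianTail L.pTx_pos L.pN_pos hh, hsq, ← Real.sqrt_sq_eq_abs,
      ← Real.sqrt_mul (by have := L.snrOpt_pos; positivity), FadingLink.snrOpt]
    congr 2
    ring
  have hm : Measurable fun x : ℝ => gaussianTail (√(2 * L.snrOpt) * |x|) :=
    measurable_gaussianTail.comp (by fun_prop)
  rw [hber, ← integral_map (f := fun x : ℝ => gaussianTail (√(2 * L.snrOpt) * |x|)) hJm
    hm.aestronglyMeasurable, hJ, integral_withDensity_eq_integral_toReal_smul
    R.measurable_pdf.ennreal_ofReal (ae_of_all _ fun _ => ENNReal.ofReal_lt_top)]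
  simp only [ENNReal.toReal_ofReal (R.pdf_nonneg _), smul_eq_mul]
  rfl

theorem Region.map_alignment_eq_of_indepFun {Ω : Type*} [MeasurableSpace Ω] {P : Measure Ω}
    [IsProbabilityMeasure P] (R : Region) (d : S2) {oTx oRx : Ω → S2}
    (hTx : HasLaw oTx uniformSphere P) (hRx : HasLaw oRx uniformSphere P)
    (hindep : IndepFun oTx oRx P) :
    HasLaw (fun ω => R.alignment d (oTx ω) (oRx ω))
      (volume.withDensity (fun x => ENNReal.ofReal (R.pdf x))) P := by
  have hprod := (indepFun_iff_hasLaw_prodMk_prod hTx hRx).1 hindep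
  have hm : Measurable (fun p : S2 × S2 => R.alignment d p.1 p.2) := by
    unfold Region.alignment
    exact (measurable_subtype_coe.comp measurable_snd).inner
      (((R.measurable_fieldVec d).comp measurable_subtype_coe).comp measurable_fst)
  have h : HasLaw (fun p : S2 × S2 => R.alignment d p.1 p.2)
      (volume.withDensity (fun x => ENNReal.ofReal (R.pdf x)))
      (uniformSphere.prod uniformSphere) :=
    ⟨hm.aemeasurable, R.map_alignment_eq_withDensity_pdf d⟩
  exact h.comp hprod

theorem proposition7 {Ω : Type*} [MeasurableSpace Ω] (P : Measure Ω) [IsProbabilityMeasure P]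
    (d : S2) (oTx oRx : Ω → S2)
    (hTx : HasLaw oTx uniformSphere P) (hRx : HasLaw oRx uniformSphere P)
    (hindep : IndepFun oTx oRx P)
    (R : Region) (J : Ω → ℝ) (hJ : J = fun ω => R.alignment d (oTx ω) (oRx ω)) :
    -- `R.pdf` is the density of the alignment factor
    P.map J = volume.withDensity (fun x => ENNReal.ofReal (R.pdf x)) ∧
    -- the bound on the bit error rate
    (∀ L : FadingLink P J, L.ber < R.pdf 0 / √(Real.pi * L.snrOpt)) ∧
    -- the bound is tight for large optimal signal-to-noise ratio
    Tendsto (fun L : FadingLink P J => L.ber / (R.pdf 0 / √(Real.pi * L.snrOpt)))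
      (comap FadingLink.snrOpt atTop) (𝓝 1) ∧
    -- the diversity exponent is one half
    HasDiversityExponent (FadingLink.snrOpt : FadingLink P J → ℝ) FadingLink.ber (1 / 2) := by
  have hlaw := R.map_alignment_eq_of_indepFun d hTx hRx hindep
  rw [← hJ] at hlaw
  have hber : ∀ L : FadingLink P J, L.ber = R.berAt L.snrOpt := fun L =>
    L.ber_eq_berAt hlaw.aemeasurable hlaw.map_eq
  have htend : Tendsto (fun L : FadingLink P J => L.ber / (R.pdf 0 / √(Real.pi * L.snrOpt)))
      (comap FadingLink.snrOpt atTop) (𝓝 1) := by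
    simp_rw [hber]
    exact R.tendsto_berAt_div.comp tendsto_comap
  refine ⟨hlaw.map_eq, fun L => ?_, htend, R.pdf 0 / √Real.pi,
    div_pos R.pdf_zero_pos (Real.sqrt_pos.2 Real.pi_pos), ?_⟩
  · rw [hber]
    exact R.berAt_lt L.snrOpt_pos
  -- The bound equals `(R.pdf 0 / √π) * snrOpt ^ (-1/2)` for every link, so the equivalence is the
  -- tightness limit rewritten.
  · refine isEquivalent_of_tendsto_one (htend.congr fun L => ?_)
    rw [Pi.div_apply, Real.rpow_neg L.snrOpt_pos.le, ← Real.sqrt_eq_rpow,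
      Real.sqrt_mul Real.pi_pos.le, ← div_eq_mul_inv, div_div]
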